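/- Let $\alpha,\beta>-1$ be real, and let $\mu$ be the Jacobi measure $d\mu(x)=(1-x)^{\alpha}(1+x)^{\beta}\,dx$ on $(-1,1)$. Let $P_n^{(\alpha,\beta)}$ ($n\ge 0$) be the monic orthogonal polynomials with respect to $\mu$, with $\|P_n^{(\alpha,\beta)}\|_\mu^2=\int_{-1}^1 \big(P_n^{(\alpha,\beta)}(x)\big)^2\,d\mu(x)$, let $$K_n(x,y)=\sum_{j=0}^{n}\frac{P_j^{(\alpha,\beta)}(x)\,P_j^{(\alpha,\beta)}(y)}{\|P_j^{(\alpha,\beta)}\|_\mu^2}$$ be their Christoffel–Darboux kernel, and write $K_n^{(k,s)}(x,y)=\dfrac{\partial^{k+s}K_n(x,y)}{\partial x^k\,\partial y^s}$. Then for all integers $k,s\ge 0$, $$\lim_{n\to+\infty}\frac{K_{n-1}^{(k,s)}(-1,-1)}{n^{2\beta+2k+2s+2}}=\frac{(-1)^{k+s}}{2^{\alpha+\beta+k+s+1}\,(\beta+k+s+1)\,\Gamma(\beta+k+1)\,\Gamma(\beta+s+1)}.$$ -/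

import Mathlib

open MeasureTheory Filter Topology Polynomial

noncomputable section

/-- The Jacobi measure `dμ(x) = (1 - x)^α (1 + x)^β dx` on the interval `(-1, 1)`. -/
def jacobiMeasure (α β : ℝ) : Measure ℝ :=
  (volume.restrict (Set.Ioo (-1 : ℝ) 1)).withDensity
    (fun x => ENNReal.ofReal ((1 - x) ^ α * (1 + x) ^ β))

/-- The pairing `⟨p, q⟩_μ = ∫ p q dμ` of two real polynomials. -/
def polyInner (μ : Measure ℝ) (p q : ℝ[X]) : ℝ :=
  ∫ x, p.eval x * q.eval x ∂μ

/-- The sequence of monic orthogonal polynomials of `μ`, constructed by the Gram–Schmidt process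
applied to `1, X, X², …` (without normalisation, so that each polynomial is monic). -/
def monicOP (μ : Measure ℝ) (n : ℕ) : ℝ[X] :=
  X ^ n - ∑ i : Fin n,
    C (polyInner μ (X ^ n) (monicOP μ i) / polyInner μ (monicOP μ i) (monicOP μ i)) *
      monicOP μ i
termination_by n
decreasing_by exact i.2

/-- The monic Jacobi polynomial `P_n^{(α,β)}`. -/
def jacobiP (α β : ℝ) (n : ℕ) : ℝ[X] :=
  monicOP (jacobiMeasure α β) n

/-- The Christoffel–Darboux kernel
`K_n(x, y) = ∑_{j=0}^{n} P_j(x) P_j(y) / ‖P_j‖²_μ` of the Jacobi polynomials. -/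
def jacobiCDKernel (α β : ℝ) (n : ℕ) (x y : ℝ) : ℝ :=
  ∑ j ∈ Finset.range (n + 1),
    (jacobiP α β j).eval x * (jacobiP α β j).eval y /
      polyInner (jacobiMeasure α β) (jacobiP α β j) (jacobiP α β j)

/-- The mixed partial derivative `K_n^{(k,s)}(x, y) = ∂^{k+s} K_n(x, y) / ∂x^k ∂y^s`. -/
def jacobiCDKernelDeriv (α β : ℝ) (n k s : ℕ) (x y : ℝ) : ℝ :=
  iteratedDeriv k (fun u => iteratedDeriv s (fun v => jacobiCDKernel α β n u v) y) x

end

/-!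
Differentiation maps `L²` of the Jacobi weight `(α, β)` to that of `(α + 1, β + 1)`, and its formal
adjoint raises degrees by one. By orthogonality both operators send monic Jacobi polynomials to
multiples of monic Jacobi polynomials, which gives recursions in `n` for the norms and for the
values at `-1` of all derivatives, hence closed forms in terms of the Gamma function. Together with
`Γ(n + a + 1) ~ n! n^a` they show that the `n`-th term of the kernel is asymptotic to a constant
times `n^(2β + 2k + 2s + 1)`, and the Stolz–Cesàro theorem yields the limit.
-/

open Asymptotics

section Asymptotics

theorem Gamma_add_natCast {x : ℝ} (hx : 0 < x) (n : ℕ) :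
    Real.Gamma (x + n) = (ascPochhammer ℝ n).eval x * Real.Gamma x := by
  induction n with
  | zero => simp
  | succ n ih =>
    have : x + n ≠ 0 := by positivity
    rw [Nat.cast_succ, ← add_assoc, Real.Gamma_add_one this, ih, ascPochhammer_succ_eval]
    ring

theorem prod_range_add_eq_ascPochhammer_eval (x : ℝ) (n : ℕ) :
    ∏ j ∈ Finset.range n, (x + j) = (ascPochhammer ℝ n).eval x := by
  induction n with
  | zero => simp
  | succ n ih => rw [Finset.prod_range_succ, ih, ascPochhammer_succ_eval]

theorem isEquivalent_natCast_add (c : ℝ) :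
    (fun n : ℕ => (n : ℝ) + c) ~[atTop] fun n : ℕ => (n : ℝ) :=
  IsEquivalent.refl.add_const_of_norm_tendsto_atTop
    (tendsto_norm_atTop_atTop.comp tendsto_natCast_atTop_atTop)

theorem isEquivalent_Gamma_natCast_add_of_pos {a : ℝ} (ha : 0 < a) :
    (fun n : ℕ => Real.Gamma (n + a + 1)) ~[atTop] fun n : ℕ => n.factorial * (n : ℝ) ^ a := by
  have hΓ : Real.Gamma a ≠ 0 := (Real.Gamma_pos_of_pos ha).ne'
  refine isEquivalent_of_tendsto_one ?_
  have hlim := ((Real.GammaSeq_tendsto_Gamma a).inv₀ hΓ).const_mul (Real.Gamma a)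
  rw [mul_inv_cancel₀ hΓ] at hlim
  refine hlim.congr fun n => ?_
  have hprod : Real.Gamma (n + a + 1) =
      (∏ j ∈ Finset.range (n + 1), (a + j)) * Real.Gamma a := by
    rw [prod_range_add_eq_ascPochhammer_eval, ← Gamma_add_natCast ha]
    push_cast
    ring_nf
  rw [Pi.div_apply, hprod, Real.GammaSeq, inv_div]
  ring

theorem isEquivalent_Gamma_natCast_add (a : ℝ) :
    (fun n : ℕ => Real.Gamma (n + a + 1)) ~[atTop] fun n : ℕ => n.factorial * (n : ℝ) ^ a := by
  suffices ∀ m : ℕ, ∀ a : ℝ, -a < m → (fun n : ℕ => Real.Gamma (n + a + 1)) ~[atTop]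
      fun n : ℕ => n.factorial * (n : ℝ) ^ a from
    (exists_nat_gt (-a)).elim fun m hm => this m a hm
  intro m
  induction m with
  | zero => exact fun a ha => isEquivalent_Gamma_natCast_add_of_pos (by simpa using ha)
  | succ m ih =>
    intro a ha
    have hdiv := (ih (a + 1) (by push_cast at ha; linarith)).div (isEquivalent_natCast_add (a + 1))
    refine (hdiv.congr_left ?_).congr_right ?_
    · filter_upwards [tendsto_natCast_atTop_atTop.eventually_gt_atTop (-(a + 1))] with n hn
      have hn' : (n : ℝ) + (a + 1) ≠ 0 := by linarith
      rw [Pi.div_apply, Real.Gamma_add_one hn', mul_div_cancel_left₀ _ hn', add_assoc]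
    · filter_upwards [eventually_ne_atTop 0] with n hn
      have hn' : (n : ℝ) ≠ 0 := Nat.cast_ne_zero.2 hn
      rw [Pi.div_apply, Real.rpow_add_one hn', ← mul_assoc, mul_div_cancel_right₀ _ hn']

theorem tendsto_sum_range_div_sum_range {a b : ℕ → ℝ} {L : ℝ} (hb : ∀ n, 0 < b n)
    (hsum : Tendsto (fun n => ∑ j ∈ Finset.range n, b j) atTop atTop)
    (hab : Tendsto (fun n => a n / b n) atTop (𝓝 L)) :
    Tendsto (fun n => (∑ j ∈ Finset.range n, a j) / ∑ j ∈ Finset.range n, b j) atTop (𝓝 L) := by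
  have hlittle : (fun n => a n - L * b n) =o[atTop] b := by
    refine (isLittleO_iff_tendsto fun n h => absurd h (hb n).ne').2 ?_
    simpa only [sub_div, mul_div_cancel_right₀ _ (hb _).ne', sub_self] using hab.sub_const L
  have hlim := (hlittle.sum_range (fun n => (hb n).le) hsum).tendsto_div_nhds_zero.add_const L
  rw [zero_add] at hlim
  refine hlim.congr' ?_
  filter_upwards [hsum.eventually_ne_atTop 0] with n hn
  rw [Finset.sum_sub_distrib, ← Finset.mul_sum, sub_div, mul_div_cancel_right₀ _ hn,
    sub_add_cancel]

theorem tendsto_rpow_add_one_sub_rpow_div (p : ℝ) :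
    Tendsto (fun n : ℕ => (((n : ℝ) + 1) ^ p - (n : ℝ) ^ p) / (n : ℝ) ^ (p - 1)) atTop (𝓝 p) := by
  have hderiv : HasDerivAt (fun x : ℝ => x ^ p) p 1 := by
    simpa using Real.hasDerivAt_rpow_const (x := 1) (p := p) (Or.inl one_ne_zero)
  have hinv : Tendsto (fun n : ℕ => (n : ℝ)⁻¹) atTop (𝓝[≠] 0) :=
    tendsto_nhdsWithin_iff.2 ⟨tendsto_inv_atTop_nhds_zero_nat, by
      filter_upwards [eventually_ne_atTop 0] with n hn
      simpa using hn⟩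
  refine (hderiv.tendsto_slope_zero.comp hinv).congr' ?_
  filter_upwards [eventually_gt_atTop 0] with n hn
  have hn' : (0 : ℝ) < n := Nat.cast_pos.2 hn
  have hfactor : (n : ℝ) + 1 = n * (1 + (n : ℝ)⁻¹) := by field_simp
  rw [Function.comp_apply, inv_inv, smul_eq_mul, Real.one_rpow, hfactor,
    Real.mul_rpow hn'.le (by positivity), Real.rpow_sub_one hn'.ne']
  field_simp

theorem tendsto_sum_range_div_rpow {a : ℕ → ℝ} {p L : ℝ} (hp : 0 < p)
    (ha : Tendsto (fun n : ℕ => a n / (n : ℝ) ^ (p - 1)) atTop (𝓝 L)) :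
    Tendsto (fun n : ℕ => (∑ j ∈ Finset.range n, a j) / (n : ℝ) ^ p) atTop (𝓝 (L / p)) := by
  have hsum (n : ℕ) : ∑ j ∈ Finset.range n, (((j : ℝ) + 1) ^ p - (j : ℝ) ^ p) = (n : ℝ) ^ p := by
    simpa [Real.zero_rpow hp.ne'] using Finset.sum_range_sub (fun j : ℕ => (j : ℝ) ^ p) n
  have hpos (n : ℕ) : 0 < ((n : ℝ) + 1) ^ p - (n : ℝ) ^ p :=
    sub_pos.2 (Real.rpow_lt_rpow n.cast_nonneg (lt_add_one _) hp)
  have hratio : Tendsto (fun n : ℕ => a n / (((n : ℝ) + 1) ^ p - (n : ℝ) ^ p)) atTop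
      (𝓝 (L / p)) := by
    refine (ha.div (tendsto_rpow_add_one_sub_rpow_div p) hp.ne').congr' ?_
    filter_upwards [eventually_gt_atTop 0] with n hn
    exact div_div_div_cancel_right₀ (Real.rpow_pos_of_pos (Nat.cast_pos.2 hn) _).ne' _ _
  have hdiverge : Tendsto (fun n : ℕ => (n : ℝ) ^ p) atTop atTop :=
    (tendsto_rpow_atTop hp).comp tendsto_natCast_atTop_atTop
  simpa only [hsum] using tendsto_sum_range_div_sum_range hpos (by simpa only [hsum]) hratio

end Asymptotics

section OrthogonalPolynomials

variable (μ : Measure ℝ)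

theorem polyInner_comm (p q : ℝ[X]) : polyInner μ p q = polyInner μ q p := by
  simp only [polyInner, mul_comm]

theorem polyInner_C_mul (c : ℝ) (p q : ℝ[X]) :
    polyInner μ (C c * p) q = c * polyInner μ p q := by
  simp only [polyInner, eval_mul, eval_C, mul_assoc, integral_const_mul]

theorem degree_monicOP_and_monic (n : ℕ) :
    (monicOP μ n).degree = n ∧ (monicOP μ n).Monic := by
  induction n using Nat.strong_induction_on with
  | _ n ih =>
    have hlt : (∑ i : Fin n, C (polyInner μ (X ^ n) (monicOP μ i) /
        polyInner μ (monicOP μ i) (monicOP μ i)) * monicOP μ i).degree <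
          (X ^ n : ℝ[X]).degree := by
      rw [degree_X_pow, ← mem_degreeLT]
      refine Submodule.sum_mem _ fun i _ => ?_
      rw [← smul_eq_C_mul]
      refine Submodule.smul_mem _ _ (mem_degreeLT.2 ?_)
      rw [(ih i i.2).1]
      exact_mod_cast i.2
    rw [monicOP]
    exact ⟨by rw [degree_sub_eq_left_of_degree_lt hlt, degree_X_pow],
      (monic_X_pow n).sub_of_left hlt⟩

theorem degree_monicOP (n : ℕ) : (monicOP μ n).degree = n :=
  (degree_monicOP_and_monic μ n).1

theorem monic_monicOP (n : ℕ) : (monicOP μ n).Monic :=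
  (degree_monicOP_and_monic μ n).2

theorem coeff_monicOP_self (n : ℕ) : (monicOP μ n).coeff n = 1 := by
  simpa only [natDegree_eq_of_degree_eq_some (degree_monicOP μ n)] using
    (monic_monicOP μ n).coeff_natDegree

theorem monicOP_mem_degreeLT (n : ℕ) : monicOP μ n ∈ degreeLT ℝ (n + 1) := by
  rw [mem_degreeLT, degree_monicOP]
  exact_mod_cast n.lt_succ_self

/-- The sequence `monicOP μ` in bundled form, giving access to Mathlib's spanning results. -/
noncomputable def monicOPSequence : Polynomial.Sequence ℝ where
  elems' := monicOP μ
  degree_eq' := degree_monicOP μ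

theorem span_monicOP (n : ℕ) :
    Submodule.span ℝ (monicOP μ '' Set.Iio n) = degreeLT ℝ n := by
  refine (monicOPSequence μ).span_degreeLT fun i _ => ?_
  change IsUnit (monicOP μ i).leadingCoeff
  rw [(monic_monicOP μ i).leadingCoeff]
  exact isUnit_one

variable {μ}

theorem polyInner_self_pos [NullSingletonClass μ] [NeZero μ]
    (hμ : ∀ p : ℝ[X], Integrable (fun x => p.eval x) μ) {p : ℝ[X]} (hp : p ≠ 0) :
    0 < polyInner μ p p := by
  have hint : Integrable (fun x => p.eval x * p.eval x) μ := by simpa using hμ (p * p)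
  rw [polyInner, integral_pos_iff_support_of_nonneg (fun x => mul_self_nonneg _) hint]
  have hroots : μ {x | p.IsRoot x} = 0 := (finite_setOfPred_isRoot hp).measure_zero μ
  have hsupport : Function.support (fun x => p.eval x * p.eval x) = {x | p.IsRoot x}ᶜ := by
    ext x
    simp [IsRoot]
  rw [hsupport, pos_iff_ne_zero]
  intro hcompl
  have hunion := measure_union_null hroots hcompl
  rw [Set.union_compl_self, Measure.measure_univ_eq_zero] at hunion
  exact NeZero.ne μ hunion

/-- The linear functional `p ↦ ⟨p, q⟩_μ`. -/
noncomputable def polyInnerLeft (hμ : ∀ p : ℝ[X], Integrable (fun x => p.eval x) μ) (q : ℝ[X]) :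
    ℝ[X] →ₗ[ℝ] ℝ where
  toFun p := polyInner μ p q
  map_add' p₁ p₂ := by
    simp only [polyInner, eval_add, add_mul]
    exact integral_add (by simpa using hμ (p₁ * q)) (by simpa using hμ (p₂ * q))
  map_smul' c p := by
    simp only [polyInner, eval_smul, smul_eq_mul, mul_assoc, integral_const_mul, RingHom.id_apply]

theorem polyInner_sub (hμ : ∀ p : ℝ[X], Integrable (fun x => p.eval x) μ) (p q r : ℝ[X]) :
    polyInner μ (p - q) r = polyInner μ p r - polyInner μ q r :=
  map_sub (polyInnerLeft hμ r) p q

theorem polyInner_sum (hμ : ∀ p : ℝ[X], Integrable (fun x => p.eval x) μ) {ι : Type*}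
    (s : Finset ι) (f : ι → ℝ[X]) (q : ℝ[X]) :
    polyInner μ (∑ i ∈ s, f i) q = ∑ i ∈ s, polyInner μ (f i) q :=
  map_sum (polyInnerLeft hμ q) f s

theorem polyInner_monicOP_of_lt
    (hμ : ∀ p : ℝ[X], Integrable (fun x => p.eval x) μ)
    (hpos : ∀ p : ℝ[X], p ≠ 0 → 0 < polyInner μ p p) {i n : ℕ} (hin : i < n) :
    polyInner μ (monicOP μ n) (monicOP μ i) = 0 := by
  induction n using Nat.strong_induction_on generalizing i with
  | _ n ih =>
    rw [monicOP, polyInner_sub hμ, polyInner_sum hμ, Finset.sum_eq_single ⟨i, hin⟩]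
    · rw [polyInner_C_mul, div_mul_cancel₀ _ (hpos _ (monic_monicOP μ i).ne_zero).ne', sub_self]
    · intro j _ hj
      rw [polyInner_C_mul]
      rcases lt_or_gt_of_ne (Fin.val_ne_of_ne hj) with h | h
      · rw [polyInner_comm μ (monicOP μ j) (monicOP μ i), ih i hin h, mul_zero]
      · rw [ih j j.2 h, mul_zero]
    · simp

theorem polyInner_monicOP_of_mem_degreeLT
    (hμ : ∀ p : ℝ[X], Integrable (fun x => p.eval x) μ)
    (hpos : ∀ p : ℝ[X], p ≠ 0 → 0 < polyInner μ p p) {n : ℕ} {r : ℝ[X]}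
    (hr : r ∈ degreeLT ℝ n) : polyInner μ r (monicOP μ n) = 0 := by
  have hspan : Submodule.span ℝ (monicOP μ '' Set.Iio n) ≤
      LinearMap.ker (polyInnerLeft hμ (monicOP μ n)) := by
    rw [Submodule.span_le]
    rintro _ ⟨i, hi, rfl⟩
    exact (polyInner_comm μ _ _).trans (polyInner_monicOP_of_lt hμ hpos hi)
  rw [span_monicOP] at hspan
  exact hspan hr

theorem eq_C_coeff_mul_monicOP
    (hμ : ∀ p : ℝ[X], Integrable (fun x => p.eval x) μ)
    (hpos : ∀ p : ℝ[X], p ≠ 0 → 0 < polyInner μ p p) {n : ℕ} {q : ℝ[X]}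
    (hq : q ∈ degreeLT ℝ (n + 1)) (horth : ∀ r ∈ degreeLT ℝ n, polyInner μ q r = 0) :
    q = C (q.coeff n) * monicOP μ n := by
  set d := q - C (q.coeff n) * monicOP μ n with hd
  have hdeg : d ∈ degreeLT ℝ n := by
    have hd' : d ∈ degreeLT ℝ (n + 1) := by
      rw [hd, ← smul_eq_C_mul]
      exact Submodule.sub_mem _ hq (Submodule.smul_mem _ _ (monicOP_mem_degreeLT μ n))
    rw [mem_degreeLT, degree_lt_iff_coeff_zero] at hd' ⊢
    intro m hm
    rcases hm.eq_or_lt with rfl | hm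
    · rw [hd, coeff_sub, coeff_C_mul, coeff_monicOP_self, mul_one, sub_self]
    · exact hd' m hm
  by_contra hne
  have hself : polyInner μ d d = 0 := by
    nth_rw 1 [hd]
    rw [polyInner_sub hμ, polyInner_C_mul, horth d hdeg, polyInner_comm μ _ d,
      polyInner_monicOP_of_mem_degreeLT hμ hpos hdeg, mul_zero, sub_zero]
  exact (hpos d (sub_ne_zero.2 hne)).ne' hself

end OrthogonalPolynomials

section JacobiMeasure

theorem integral_rpow_mul_sub_rpow {u v a : ℝ} (hu : 0 < u) (hv : 0 < v) (ha : 0 < a) :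
    ∫ x in (0 : ℝ)..a, x ^ (u - 1) * (a - x) ^ (v - 1) =
      a ^ (u + v - 1) * ProbabilityTheory.beta u v := by
  have hcomplex : ((∫ x in (0 : ℝ)..a, x ^ (u - 1) * (a - x) ^ (v - 1) : ℝ) : ℂ) =
      ∫ x in (0 : ℝ)..a, (x : ℂ) ^ ((u : ℂ) - 1) * ((a : ℂ) - x) ^ ((v : ℂ) - 1) := by
    rw [← intervalIntegral.integral_ofReal]
    refine intervalIntegral.integral_congr fun x hx => ?_
    rw [Set.uIcc_of_le ha.le] at hx
    rw [Complex.ofReal_mul, Complex.ofReal_cpow hx.1, Complex.ofReal_cpow (sub_nonneg.2 hx.2)]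
    push_cast
    rfl
  have hpow : (a : ℂ) ^ ((u : ℂ) + v - 1) = ((a ^ (u + v - 1) : ℝ) : ℂ) := by
    rw [Complex.ofReal_cpow ha.le]
    push_cast
    rfl
  rw [Complex.betaIntegral_scaled _ _ ha, hpow] at hcomplex
  rw [ProbabilityTheory.beta_eq_betaIntegralReal u v hu hv, ← Complex.re_ofReal_mul, ← hcomplex,
    Complex.ofReal_re]

theorem integral_one_sub_rpow_mul_one_add_rpow {α β : ℝ} (hα : -1 < α) (hβ : -1 < β) :
    ∫ x in (-1 : ℝ)..1, (1 - x) ^ α * (1 + x) ^ β =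
      2 ^ (α + β + 1) * ProbabilityTheory.beta (β + 1) (α + 1) := by
  have hshift : ∫ x in (-1 : ℝ)..1, (1 - x) ^ α * (1 + x) ^ β =
      ∫ x in (1 + -1 : ℝ)..(1 + 1), x ^ β * (2 - x) ^ α := by
    rw [← intervalIntegral.integral_comp_add_left (fun x : ℝ => x ^ β * (2 - x) ^ α) 1]
    refine intervalIntegral.integral_congr fun x _ => ?_
    rw [mul_comm, show 2 - (1 + x) = 1 - x by ring]
  have hbeta := integral_rpow_mul_sub_rpow (u := β + 1) (v := α + 1) (by linarith) (by linarith)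
    two_pos
  rw [hshift, add_neg_cancel, one_add_one_eq_two, show α + β + 1 = β + 1 + (α + 1) - 1 by ring,
    ← hbeta]
  simp only [add_sub_cancel_right]

theorem integral_jacobiMeasure (α β : ℝ) (f : ℝ → ℝ) :
    ∫ x, f x ∂jacobiMeasure α β = ∫ x in (-1 : ℝ)..1, (1 - x) ^ α * (1 + x) ^ β * f x := by
  rw [jacobiMeasure, integral_withDensity_eq_integral_toReal_smul (by fun_prop) (by simp),
    intervalIntegral.integral_of_le (by norm_num), integral_Ioc_eq_integral_Ioo]
  refine setIntegral_congr_fun measurableSet_Ioo fun x hx => ?_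
  have hminus : 0 ≤ 1 - x := by linarith [hx.2]
  have hplus : 0 ≤ 1 + x := by linarith [hx.1]
  rw [ENNReal.toReal_ofReal (by positivity), smul_eq_mul]

theorem integral_one_jacobiMeasure {α β : ℝ} (hα : -1 < α) (hβ : -1 < β) :
    ∫ _, (1 : ℝ) ∂jacobiMeasure α β =
      2 ^ (α + β + 1) * ProbabilityTheory.beta (β + 1) (α + 1) := by
  simp only [integral_jacobiMeasure, mul_one, integral_one_sub_rpow_mul_one_add_rpow hα hβ]

theorem integral_one_jacobiMeasure_pos {α β : ℝ} (hα : -1 < α) (hβ : -1 < β) :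
    0 < ∫ _, (1 : ℝ) ∂jacobiMeasure α β := by
  rw [integral_one_jacobiMeasure hα hβ]
  exact mul_pos (by positivity) (ProbabilityTheory.beta_pos (by linarith) (by linarith))

theorem ae_mem_Ioo_jacobiMeasure (α β : ℝ) : ∀ᵐ x ∂jacobiMeasure α β, x ∈ Set.Ioo (-1) 1 :=
  (withDensity_absolutelyContinuous _ _).ae_le (ae_restrict_mem measurableSet_Ioo)

theorem integrable_eval_jacobiMeasure {α β : ℝ} (hα : -1 < α) (hβ : -1 < β) (p : ℝ[X]) :
    Integrable (fun x => p.eval x) (jacobiMeasure α β) := by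
  obtain ⟨M, hM⟩ := isCompact_Icc.exists_bound_of_continuousOn (p.continuous.continuousOn)
  have hone := Integrable.of_integral_ne_zero (integral_one_jacobiMeasure_pos hα hβ).ne'
  refine (hone.const_mul M).mono' p.continuous.aestronglyMeasurable ?_
  filter_upwards [ae_mem_Ioo_jacobiMeasure α β] with x hx
  simpa only [mul_one] using hM x (Set.Ioo_subset_Icc_self hx)

theorem polyInner_jacobiMeasure_self_pos {α β : ℝ} (hα : -1 < α) (hβ : -1 < β) {p : ℝ[X]}
    (hp : p ≠ 0) : 0 < polyInner (jacobiMeasure α β) p p := by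
  have : NullSingletonClass (jacobiMeasure α β) :=
    ⟨fun x => withDensity_absolutelyContinuous _ _ (measure_singleton x)⟩
  have : NeZero (jacobiMeasure α β) := ⟨fun h => by
    simpa [h] using (integral_one_jacobiMeasure_pos hα hβ).ne'⟩
  exact polyInner_self_pos (integrable_eval_jacobiMeasure hα hβ) hp

theorem eq_C_coeff_mul_jacobiP {α β : ℝ} (hα : -1 < α) (hβ : -1 < β) {n : ℕ} {q : ℝ[X]}
    (hq : q ∈ degreeLT ℝ (n + 1))
    (horth : ∀ r ∈ degreeLT ℝ n, polyInner (jacobiMeasure α β) q r = 0) :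
    q = C (q.coeff n) * jacobiP α β n :=
  eq_C_coeff_mul_monicOP (integrable_eval_jacobiMeasure hα hβ)
    (fun _ => polyInner_jacobiMeasure_self_pos hα hβ) hq horth

theorem polyInner_jacobiP_of_mem_degreeLT {α β : ℝ} (hα : -1 < α) (hβ : -1 < β) {n : ℕ}
    {r : ℝ[X]} (hr : r ∈ degreeLT ℝ n) :
    polyInner (jacobiMeasure α β) r (jacobiP α β n) = 0 :=
  polyInner_monicOP_of_mem_degreeLT (integrable_eval_jacobiMeasure hα hβ)
    (fun _ => polyInner_jacobiMeasure_self_pos hα hβ) hr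

end JacobiMeasure

section RaisingOperator

/-- The raising operator `q ↦ -w⁻¹ ((1 - x²) w q)'` for the weight `w = (1 - x)^α (1 + x)^β`, with
the division by `w` carried out. It is the adjoint of differentiation as a map from the space with
parameters `(α, β)` to that with parameters `(α + 1, β + 1)`. -/
noncomputable def jacobiRaise (α β : ℝ) (q : ℝ[X]) : ℝ[X] :=
  (C (α + 1) * (1 + X) - C (β + 1) * (1 - X)) * q - (1 - X ^ 2) * derivative q

theorem intervalIntegrable_jacobiWeight_mul_eval {α β : ℝ} (hα : -1 < α) (hβ : -1 < β) (p : ℝ[X]) :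
    IntervalIntegrable (fun x => (1 - x) ^ α * (1 + x) ^ β * p.eval x) volume (-1) 1 := by
  refine (intervalIntegral.intervalIntegrable_of_integral_ne_zero ?_).mul_continuousOn
    p.continuous.continuousOn
  simpa only [integral_jacobiMeasure, mul_one] using (integral_one_jacobiMeasure_pos hα hβ).ne'

theorem hasDerivAt_jacobiWeight_mul_eval {x : ℝ} (hx : x ∈ Set.Ioo (-1) 1) (α β : ℝ) (p q : ℝ[X]) :
    HasDerivAt (fun x => (1 - x) ^ (α + 1) * (1 + x) ^ (β + 1) * (p * q).eval x)
      ((1 - x) ^ (α + 1) * (1 + x) ^ (β + 1) * (derivative p * q).eval x -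
        (1 - x) ^ α * (1 + x) ^ β * (p * jacobiRaise α β q).eval x) x := by
  have hminus : 1 - x ≠ 0 := (sub_pos.2 hx.2).ne'
  have hplus : 1 + x ≠ 0 := by linarith [hx.1]
  have hleft := ((hasDerivAt_id x).const_sub 1).rpow_const (p := α + 1) (Or.inl hminus)
  have hright := ((hasDerivAt_id x).const_add 1).rpow_const (p := β + 1) (Or.inl hplus)
  refine ((hleft.mul hright).mul ((p * q).hasDerivAt x)).congr_deriv ?_
  simp only [jacobiRaise, derivative_mul, eval_add, eval_sub, eval_mul, eval_pow, eval_C, eval_one,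
    eval_X, id, Pi.mul_apply, add_sub_cancel_right, Real.rpow_add_one hminus,
    Real.rpow_add_one hplus]
  ring

theorem polyInner_derivative {α β : ℝ} (hα : -1 < α) (hβ : -1 < β) (p q : ℝ[X]) :
    polyInner (jacobiMeasure (α + 1) (β + 1)) (derivative p) q =
      polyInner (jacobiMeasure α β) p (jacobiRaise α β q) := by
  have hp := intervalIntegrable_jacobiWeight_mul_eval (α := α + 1) (β := β + 1) (by linarith)
    (by linarith) (derivative p * q)
  have hq := intervalIntegrable_jacobiWeight_mul_eval hα hβ (p * jacobiRaise α β q)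
  have hcont : ContinuousOn (fun x => (1 - x) ^ (α + 1) * (1 + x) ^ (β + 1) * (p * q).eval x)
      (Set.Icc (-1) 1) := by
    have hα' : 0 ≤ α + 1 := by linarith
    have hβ' : 0 ≤ β + 1 := by linarith
    fun_prop (disch := assumption)
  have hftc := intervalIntegral.integral_eq_sub_of_hasDerivAt_of_le (by norm_num) hcont
    (fun x hx => hasDerivAt_jacobiWeight_mul_eval hx α β p q) (hp.sub hq)
  rw [intervalIntegral.integral_sub hp hq] at hftc
  norm_num [Real.zero_rpow (show α + 1 ≠ 0 by linarith),
    Real.zero_rpow (show β + 1 ≠ 0 by linarith), sub_eq_zero] at hftc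
  simpa only [polyInner, integral_jacobiMeasure] using hftc

theorem coeff_jacobiRaise_succ (α β : ℝ) (q : ℝ[X]) (m : ℕ) :
    (jacobiRaise α β q).coeff (m + 1) = (α + β + m + 2) * q.coeff m +
      (α - β) * q.coeff (m + 1) - (m + 2) * q.coeff (m + 2) := by
  have hexpand : jacobiRaise α β q = C (α - β) * q + C (α + β + 2) * (X * q) - derivative q +
      X * (X * derivative q) := by
    simp only [jacobiRaise, map_add, map_sub, map_one, map_ofNat]
    ring
  have hshift : (X * (X * derivative q)).coeff (m + 1) = m * q.coeff m := by
    rw [coeff_X_mul]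
    cases m with
    | zero => simp
    | succ m =>
      rw [coeff_X_mul, coeff_derivative]
      push_cast
      ring
  rw [hexpand, coeff_add, hshift, coeff_sub, coeff_add, coeff_C_mul, coeff_C_mul, coeff_X_mul,
    coeff_derivative]
  push_cast
  ring

theorem jacobiRaise_mem_degreeLT (α β : ℝ) {n : ℕ} {q : ℝ[X]} (hq : q ∈ degreeLT ℝ n) :
    jacobiRaise α β q ∈ degreeLT ℝ (n + 1) := by
  rw [mem_degreeLT, degree_lt_iff_coeff_zero] at hq ⊢
  intro m hm
  obtain ⟨m, rfl⟩ := Nat.exists_eq_succ_of_ne_zero (show m ≠ 0 by omega)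
  rw [Nat.succ_eq_add_one, coeff_jacobiRaise_succ, hq m (by omega), hq (m + 1) (by omega),
    hq (m + 2) (by omega)]
  ring

theorem eval_neg_one_jacobiRaise (α β : ℝ) (q : ℝ[X]) :
    (jacobiRaise α β q).eval (-1) = -2 * (β + 1) * q.eval (-1) := by
  simp only [jacobiRaise, eval_sub, eval_mul, eval_add, eval_C, eval_one, eval_X, eval_pow]
  ring

end RaisingOperator

section JacobiPolynomials

theorem jacobiP_zero (α β : ℝ) : jacobiP α β 0 = 1 := by
  rw [jacobiP, monicOP, Fin.sum_univ_zero, sub_zero, pow_zero]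

theorem derivative_jacobiP {α β : ℝ} (hα : -1 < α) (hβ : -1 < β) (n : ℕ) :
    derivative (jacobiP α β (n + 1)) = C ((n : ℝ) + 1) * jacobiP (α + 1) (β + 1) n := by
  have hmem : derivative (jacobiP α β (n + 1)) ∈ degreeLT ℝ (n + 1) := by
    rw [mem_degreeLT, ← degree_monicOP (jacobiMeasure α β) (n + 1)]
    exact degree_derivative_lt (monic_monicOP _ _).ne_zero
  have hcoeff : (derivative (jacobiP α β (n + 1))).coeff n = n + 1 := by
    rw [coeff_derivative, jacobiP, coeff_monicOP_self, one_mul]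
  rw [← hcoeff]
  refine eq_C_coeff_mul_jacobiP (by linarith) (by linarith) hmem fun r hr => ?_
  rw [polyInner_derivative hα hβ, polyInner_comm]
  exact polyInner_jacobiP_of_mem_degreeLT hα hβ (jacobiRaise_mem_degreeLT α β hr)

theorem jacobiRaise_jacobiP {α β : ℝ} (hα : -1 < α) (hβ : -1 < β) (n : ℕ) :
    jacobiRaise α β (jacobiP (α + 1) (β + 1) n) = C (α + β + n + 2) * jacobiP α β (n + 1) := by
  have hmem : jacobiP (α + 1) (β + 1) n ∈ degreeLT ℝ (n + 1) := monicOP_mem_degreeLT _ _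
  have hvanish : ∀ m, n < m → (jacobiP (α + 1) (β + 1) n).coeff m = 0 :=
    degree_lt_iff_coeff_zero _ _ |>.1 (mem_degreeLT.1 hmem)
  have hcoeff : (jacobiRaise α β (jacobiP (α + 1) (β + 1) n)).coeff (n + 1) = α + β + n + 2 := by
    rw [coeff_jacobiRaise_succ, hvanish (n + 1) (by omega), hvanish (n + 2) (by omega), jacobiP,
      coeff_monicOP_self]
    ring
  rw [← hcoeff]
  refine eq_C_coeff_mul_jacobiP hα hβ (jacobiRaise_mem_degreeLT α β hmem) fun r hr => ?_
  rw [polyInner_comm, ← polyInner_derivative hα hβ]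
  refine polyInner_jacobiP_of_mem_degreeLT (by linarith) (by linarith) ?_
  rw [mem_degreeLT, degree_lt_iff_coeff_zero] at hr ⊢
  intro m hm
  rw [coeff_derivative, hr (m + 1) (by omega), zero_mul]

theorem polyInner_jacobiP_succ_self {α β : ℝ} (hα : -1 < α) (hβ : -1 < β) (n : ℕ) :
    (α + β + n + 2) * polyInner (jacobiMeasure α β) (jacobiP α β (n + 1)) (jacobiP α β (n + 1)) =
      (n + 1) * polyInner (jacobiMeasure (α + 1) (β + 1)) (jacobiP (α + 1) (β + 1) n)
        (jacobiP (α + 1) (β + 1) n) := by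
  rw [← polyInner_C_mul, ← polyInner_C_mul, ← jacobiRaise_jacobiP hα hβ, ← derivative_jacobiP hα hβ,
    polyInner_derivative hα hβ, polyInner_comm]

theorem eval_neg_one_jacobiP_succ {α β : ℝ} (hα : -1 < α) (hβ : -1 < β) (n : ℕ) :
    (α + β + n + 2) * (jacobiP α β (n + 1)).eval (-1) =
      -2 * (β + 1) * (jacobiP (α + 1) (β + 1) n).eval (-1) := by
  rw [← eval_neg_one_jacobiRaise α, jacobiRaise_jacobiP hα hβ, eval_mul, eval_C]

theorem ascPochhammer_eval_succ_left (n : ℕ) (x : ℝ) :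
    (ascPochhammer ℝ (n + 1)).eval x = x * (ascPochhammer ℝ n).eval (x + 1) := by
  simp [ascPochhammer_succ_left]

theorem ascPochhammer_mul_polyInner_jacobiP {α β : ℝ} (hα : -1 < α) (hβ : -1 < β) (n : ℕ) :
    (ascPochhammer ℝ n).eval (α + β + n + 1) *
        polyInner (jacobiMeasure α β) (jacobiP α β n) (jacobiP α β n) =
      n.factorial * 2 ^ (α + β + 2 * n + 1) *
        ProbabilityTheory.beta (β + n + 1) (α + n + 1) := by
  induction n generalizing α β with
  | zero => simpa [polyInner, jacobiP_zero] using integral_one_jacobiMeasure hα hβ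
  | succ n ih =>
    have hrec := polyInner_jacobiP_succ_self hα hβ n
    have hih := ih (α := α + 1) (β := β + 1) (by linarith) (by linarith)
    rw [ascPochhammer_eval_succ_left, Nat.factorial_succ]
    push_cast
    rw [show α + 1 + (β + 1) + (n : ℝ) + 1 = α + β + (n + 1) + 1 + 1 by ring,
      show α + 1 + (β + 1) + 2 * (n : ℝ) + 1 = α + β + 2 * (n + 1) + 1 by ring,
      show β + 1 + (n : ℝ) + 1 = β + (n + 1) + 1 by ring,
      show α + 1 + (n : ℝ) + 1 = α + (n + 1) + 1 by ring] at hih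
    linear_combination ((n : ℝ) + 1) * hih +
      (ascPochhammer ℝ n).eval (α + β + (n + 1) + 1 + 1) * hrec

theorem ascPochhammer_mul_eval_neg_one_jacobiP {α β : ℝ} (hα : -1 < α) (hβ : -1 < β) (n : ℕ) :
    (ascPochhammer ℝ n).eval (α + β + n + 1) * (jacobiP α β n).eval (-1) =
      (-2) ^ n * (ascPochhammer ℝ n).eval (β + 1) := by
  induction n generalizing α β with
  | zero => simp [jacobiP_zero]
  | succ n ih =>
    have hrec := eval_neg_one_jacobiP_succ hα hβ n
    have hih := ih (α := α + 1) (β := β + 1) (by linarith) (by linarith)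
    rw [ascPochhammer_eval_succ_left, ascPochhammer_eval_succ_left]
    push_cast
    rw [show α + 1 + (β + 1) + (n : ℝ) + 1 = α + β + (n + 1) + 1 + 1 by ring] at hih
    linear_combination (-2 * (β + 1)) * hih +
      (ascPochhammer ℝ n).eval (α + β + (n + 1) + 1 + 1) * hrec

theorem iterate_derivative_jacobiP {α β : ℝ} (hα : -1 < α) (hβ : -1 < β) (n k : ℕ) :
    derivative^[k] (jacobiP α β (n + k)) =
      C ((n + k).descFactorial k : ℝ) * jacobiP (α + k) (β + k) n := by
  induction k generalizing α β with
  | zero => simp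
  | succ k ih =>
    rw [Function.iterate_succ_apply, ← add_assoc, derivative_jacobiP hα hβ,
      iterate_derivative_C_mul, ih (by linarith) (by linarith), ← mul_assoc, ← C_mul,
      Nat.succ_descFactorial_succ]
    push_cast
    rw [add_assoc α, add_comm 1 (k : ℝ), add_assoc β, add_comm 1 (k : ℝ)]

theorem polyInner_jacobiP_self {α β : ℝ} (hα : -1 < α) (hβ : -1 < β) {n : ℕ} (hn : 1 ≤ n) :
    polyInner (jacobiMeasure α β) (jacobiP α β n) (jacobiP α β n) =
      n.factorial * 2 ^ (α + β + 2 * n + 1) * (Real.Gamma (n + α + 1) * Real.Gamma (n + β + 1) *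
        Real.Gamma (n + (α + β) + 1)) /
          ((α + β + 2 * n + 1) * Real.Gamma (α + β + 2 * n + 1) ^ 2) := by
  have hn' : (1 : ℝ) ≤ n := Nat.one_le_cast.2 hn
  have hΓ := (Real.Gamma_pos_of_pos (show 0 < n + (α + β) + 1 by linarith)).ne'
  have hc : 0 < α + β + 2 * n + 1 := by linarith
  have hΓ' := (Real.Gamma_pos_of_pos hc).ne'
  have hasc := Gamma_add_natCast (show 0 < n + (α + β) + 1 by linarith) n
  have hself := ascPochhammer_mul_polyInner_jacobiP hα hβ n
  rw [show α + β + n + 1 = n + (α + β) + 1 by ring, eq_div_of_mul_eq hΓ hasc.symm,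
    show n + (α + β) + 1 + n = α + β + 2 * n + 1 by ring, ProbabilityTheory.beta,
    show β + n + 1 + (α + n + 1) = α + β + 2 * n + 1 + 1 by ring, Real.Gamma_add_one hc.ne',
    add_comm β, add_comm α (n : ℝ)] at hself
  rw [eq_div_iff (by positivity)]
  field_simp at hself
  linear_combination hself

theorem eval_neg_one_iterate_derivative_jacobiP {α β : ℝ} (hα : -1 < α) (hβ : -1 < β) {n k : ℕ}
    (hn : 1 ≤ n) (hk : k ≤ n) :
    (derivative^[k] (jacobiP α β n)).eval (-1) =
      n.descFactorial k * (-2) ^ (n - k) * (Real.Gamma (n + β + 1) / Real.Gamma (β + k + 1)) *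
        (Real.Gamma (n + (α + β + k) + 1) / Real.Gamma (α + β + 2 * n + 1)) := by
  obtain ⟨m, rfl⟩ := Nat.exists_eq_add_of_le' hk
  have hn' : (1 : ℝ) ≤ (m + k : ℕ) := Nat.one_le_cast.2 hn
  push_cast at hn' ⊢
  have hβk : 0 < β + k + 1 := by linarith
  have hx : 0 < m + k + (α + β + k) + 1 := by linarith
  have hval := ascPochhammer_mul_eval_neg_one_jacobiP (α := α + k) (β := β + k) (by linarith)
    (by linarith) m
  have hnum := Gamma_add_natCast hβk m
  have hden := Gamma_add_natCast hx m
  rw [show β + k + 1 + m = m + k + β + 1 by ring] at hnum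
  rw [show m + k + (α + β + k) + 1 + m = α + β + 2 * (m + k) + 1 by ring] at hden
  rw [show α + k + (β + k) + m + 1 = m + k + (α + β + k) + 1 by ring] at hval
  have hasc : (ascPochhammer ℝ m).eval (m + k + (α + β + k) + 1) ≠ 0 :=
    (ascPochhammer_pos m _ hx).ne'
  have hΓ := (Real.Gamma_pos_of_pos hβk).ne'
  have hΓ' := (Real.Gamma_pos_of_pos hx).ne'
  rw [iterate_derivative_jacobiP hα hβ, eval_mul, eval_C, hnum, hden, Nat.add_sub_cancel]
  field_simp
  linear_combination hval

end JacobiPolynomials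

section ChristoffelDarbouxKernel

/-- The contribution of the single polynomial `P_n^{(α,β)}` to the mixed partial derivative
`K_m^{(k,s)}(x, y)`, `m ≥ n`, of the Christoffel–Darboux kernel. -/
noncomputable def jacobiCDKernelDerivTerm (α β : ℝ) (n k s : ℕ) (x y : ℝ) : ℝ :=
  (derivative^[k] (jacobiP α β n)).eval x * (derivative^[s] (jacobiP α β n)).eval y /
    polyInner (jacobiMeasure α β) (jacobiP α β n) (jacobiP α β n)

theorem iteratedDeriv_eval (p : ℝ[X]) (k : ℕ) :
    iteratedDeriv k (fun x => p.eval x) = fun x => (derivative^[k] p).eval x := by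
  induction k with
  | zero => simp
  | succ k ih =>
    rw [iteratedDeriv_succ, ih, Function.iterate_succ_apply']
    funext x
    exact Polynomial.deriv _

theorem iteratedDeriv_sum_mul_eval {ι : Type*} (t : Finset ι) (c : ι → ℝ) (p : ι → ℝ[X]) (k : ℕ)
    (x : ℝ) : iteratedDeriv k (fun u => ∑ j ∈ t, c j * (p j).eval u) x =
      ∑ j ∈ t, c j * (derivative^[k] (p j)).eval x := by
  have hpoly : (fun u => ∑ j ∈ t, c j * (p j).eval u) =
      fun u => (∑ j ∈ t, C (c j) * p j).eval u := by
    simp only [eval_finsetSum, eval_mul, eval_C]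
  rw [hpoly, iteratedDeriv_eval]
  simp only [iterate_derivative_sum, iterate_derivative_C_mul, eval_finsetSum, eval_mul, eval_C]

theorem jacobiCDKernelDeriv_eq_sum_term (α β : ℝ) (n k s : ℕ) (x y : ℝ) :
    jacobiCDKernelDeriv α β n k s x y =
      ∑ j ∈ Finset.range (n + 1), jacobiCDKernelDerivTerm α β j k s x y := by
  have hinner (u : ℝ) : iteratedDeriv s (fun v => jacobiCDKernel α β n u v) y =
      ∑ j ∈ Finset.range (n + 1), (derivative^[s] (jacobiP α β j)).eval y /
        polyInner (jacobiMeasure α β) (jacobiP α β j) (jacobiP α β j) * (jacobiP α β j).eval u := by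
    simp only [jacobiCDKernel, mul_div_right_comm, iteratedDeriv_sum_mul_eval]
    exact Finset.sum_congr rfl fun j _ => by ring
  simp only [jacobiCDKernelDeriv, hinner, iteratedDeriv_sum_mul_eval]
  exact Finset.sum_congr rfl fun j _ => by rw [jacobiCDKernelDerivTerm]; ring

theorem neg_two_pow_sub_mul_neg_two_pow_sub {n k s : ℕ} (hk : k ≤ n) (hs : s ≤ n) (c : ℝ) :
    (-2 : ℝ) ^ (n - k) * (-2) ^ (n - s) * 2 ^ (c + k + s + 1) =
      (-1) ^ (k + s) * 2 ^ (c + 2 * n + 1) := by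
  have hparity : (-1 : ℝ) ^ (k + s) = (-1) ^ (n - k) * (-1) ^ (n - s) := by
    rw [← pow_add, neg_one_pow_congr]
    simp only [Nat.even_add, Nat.even_sub hk, Nat.even_sub hs]
    tauto
  have hpow : (2 : ℝ) ^ (c + 2 * n + 1) = 2 ^ (n - k) * 2 ^ (n - s) * 2 ^ (c + k + s + 1) := by
    rw [← Real.rpow_natCast, ← Real.rpow_natCast, Nat.cast_sub hk, Nat.cast_sub hs,
      ← Real.rpow_add two_pos, ← Real.rpow_add two_pos]
    congr 1
    ring
  rw [neg_pow, neg_pow 2 (n - s), hparity, hpow]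
  ring

theorem jacobiCDKernelDerivTerm_neg_one {α β : ℝ} (hα : -1 < α) (hβ : -1 < β) {n k s : ℕ}
    (hn : 1 ≤ n) (hk : k ≤ n) (hs : s ≤ n) :
    jacobiCDKernelDerivTerm α β n k s (-1) (-1) =
      (-1) ^ (k + s) / (2 ^ (α + β + k + s + 1) * Real.Gamma (β + k + 1) *
          Real.Gamma (β + s + 1)) *
        (n.descFactorial k * n.descFactorial s * Real.Gamma (n + β + 1) *
          Real.Gamma (n + (α + β + k) + 1) * Real.Gamma (n + (α + β + s) + 1) *
          (2 * (n + (α + β + 1) / 2)) /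
        (n.factorial * Real.Gamma (n + α + 1) * Real.Gamma (n + (α + β) + 1))) := by
  have hn' : (1 : ℝ) ≤ n := Nat.one_le_cast.2 hn
  have hsign := neg_two_pow_sub_mul_neg_two_pow_sub hk hs (α + β)
  have hc : 0 < α + β + 2 * n + 1 := by linarith
  have hΓα := Real.Gamma_pos_of_pos (show 0 < n + α + 1 by linarith)
  have hΓβ := Real.Gamma_pos_of_pos (show 0 < n + β + 1 by linarith)
  have hΓαβ := Real.Gamma_pos_of_pos (show 0 < n + (α + β) + 1 by linarith)
  have hΓk := Real.Gamma_pos_of_pos (show 0 < β + k + 1 by linarith)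
  have hΓs := Real.Gamma_pos_of_pos (show 0 < β + s + 1 by linarith)
  rw [jacobiCDKernelDerivTerm, eval_neg_one_iterate_derivative_jacobiP hα hβ hn hk,
    eval_neg_one_iterate_derivative_jacobiP hα hβ hn hs, polyInner_jacobiP_self hα hβ hn,
    show 2 * (n + (α + β + 1) / 2) = α + β + 2 * n + 1 by ring]
  field_simp
  linear_combination (n.descFactorial k * n.descFactorial s * Real.Gamma (n + (α + β + k) + 1) *
    Real.Gamma (n + (α + β + s) + 1)) * hsign

theorem isEquivalent_jacobiCDKernelDerivTerm_neg_one {α β : ℝ} (hα : -1 < α) (hβ : -1 < β)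
    (k s : ℕ) :
    (fun n : ℕ => jacobiCDKernelDerivTerm α β n k s (-1) (-1)) ~[atTop]
      fun n : ℕ => (-1) ^ (k + s) / (2 ^ (α + β + k + s + 1) * Real.Gamma (β + k + 1) *
        Real.Gamma (β + s + 1)) * (2 * (n : ℝ) ^ (2 * β + 2 * k + 2 * s + 1)) := by
  have hfactors := (IsEquivalent.refl (u := fun _ : ℕ => (-1 : ℝ) ^ (k + s) /
    (2 ^ (α + β + k + s + 1) * Real.Gamma (β + k + 1) * Real.Gamma (β + s + 1)))).mul
    (((((((isEquivalent_descFactorial k).mul (isEquivalent_descFactorial s)).mul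
      (isEquivalent_Gamma_natCast_add β)).mul (isEquivalent_Gamma_natCast_add (α + β + k))).mul
      (isEquivalent_Gamma_natCast_add (α + β + s))).mul
      ((IsEquivalent.refl (u := fun _ : ℕ => (2 : ℝ))).mul
        (isEquivalent_natCast_add ((α + β + 1) / 2)))).div
    (((IsEquivalent.refl (u := fun n : ℕ => (n.factorial : ℝ))).mul
      (isEquivalent_Gamma_natCast_add α)).mul (isEquivalent_Gamma_natCast_add (α + β))))
  refine (hfactors.congr_left ?_).congr_right ?_
  · filter_upwards [eventually_ge_atTop 1, eventually_ge_atTop k, eventually_ge_atTop s]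
      with n hn hk hs
    rw [jacobiCDKernelDerivTerm_neg_one hα hβ hn hk hs]
    rfl
  · filter_upwards [eventually_gt_atTop 0] with n hn
    have hn' : (0 : ℝ) < n := Nat.cast_pos.2 hn
    simp only [Pi.mul_apply, Pi.div_apply]
    congr 1
    have hpow : (n : ℝ) ^ (2 * β + 2 * k + 2 * s + 1) =
        n ^ β * n ^ β * (n ^ k) ^ 2 * (n ^ s) ^ 2 * n := by
      rw [two_mul β]
      simp only [Real.rpow_add hn', Real.rpow_one, mul_comm (2 : ℝ), Real.rpow_mul hn'.le,
        Real.rpow_natCast, Real.rpow_two]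
    simp only [hpow, Real.rpow_add hn', Real.rpow_natCast]
    field_simp

theorem tendsto_jacobiCDKernelDerivTerm_neg_one_div {α β : ℝ} (hα : -1 < α) (hβ : -1 < β)
    (k s : ℕ) :
    Tendsto (fun n : ℕ => jacobiCDKernelDerivTerm α β n k s (-1) (-1) /
        (n : ℝ) ^ (2 * β + 2 * k + 2 * s + 2 - 1)) atTop
      (𝓝 ((-1) ^ (k + s) / (2 ^ (α + β + k + s + 1) * Real.Gamma (β + k + 1) *
        Real.Gamma (β + s + 1)) * 2)) := by
  refine ((isEquivalent_jacobiCDKernelDerivTerm_neg_one hα hβ k s).div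
    IsEquivalent.refl).tendsto_nhds_iff.2 ?_
  refine tendsto_const_nhds.congr' ?_
  filter_upwards [eventually_gt_atTop 0] with n hn
  have hn' : (n : ℝ) ^ (2 * β + 2 * k + 2 * s + 1) ≠ 0 :=
    (Real.rpow_pos_of_pos (Nat.cast_pos.2 hn) _).ne'
  rw [Pi.div_apply, show 2 * β + 2 * (k : ℝ) + 2 * s + 2 - 1 = 2 * β + 2 * k + 2 * s + 1 by ring,
    ← mul_assoc, mul_div_cancel_right₀ _ hn']

end ChristoffelDarbouxKernel

theorem lemma4p3 (α β : ℝ) (hα : -1 < α) (hβ : -1 < β) (k s : ℕ) :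
    Tendsto
      (fun n : ℕ => jacobiCDKernelDeriv α β (n - 1) k s (-1) (-1) /
        (n : ℝ) ^ (2 * β + 2 * (k : ℝ) + 2 * (s : ℝ) + 2))
      atTop
      (𝓝 ((-1 : ℝ) ^ (k + s) /
        ((2 : ℝ) ^ (α + β + (k : ℝ) + (s : ℝ) + 1) * (β + (k : ℝ) + (s : ℝ) + 1) *
          Real.Gamma (β + (k : ℝ) + 1) * Real.Gamma (β + (s : ℝ) + 1)))) := by
  have hp : 0 < 2 * β + 2 * (k : ℝ) + 2 * (s : ℝ) + 2 := by linarith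
  have hlim := tendsto_sum_range_div_rpow hp (tendsto_jacobiCDKernelDerivTerm_neg_one_div hα hβ k s)
  have hconst : (-1 : ℝ) ^ (k + s) / (2 ^ (α + β + k + s + 1) * Real.Gamma (β + k + 1) *
      Real.Gamma (β + s + 1)) * 2 / (2 * β + 2 * k + 2 * s + 2) =
        (-1) ^ (k + s) / (2 ^ (α + β + k + s + 1) * (β + k + s + 1) * Real.Gamma (β + k + 1) *
          Real.Gamma (β + s + 1)) := by
    rw [show 2 * β + 2 * (k : ℝ) + 2 * s + 2 = (β + k + s + 1) * 2 by ring,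
      mul_div_mul_right _ _ two_ne_zero, div_div]
    congr 1
    ring
  rw [hconst] at hlim
  refine hlim.congr' ?_
  filter_upwards [eventually_ge_atTop 1] with n hn
  rw [jacobiCDKernelDeriv_eq_sum_term, Nat.sub_add_cancel hn]
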